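/- For all real $\alpha,\eta>0$ and every $d\in\mathbb{N}$ there exist a positive integer $\ell=\ell(\alpha,d,\eta)$ and a constant $\delta=\delta(\alpha,d,\eta)>0$ such that the following holds. Let $N_1,\dots,N_d$ be positive integers, let $P=([-N_1,N_1]\times\cdots\times[-N_d,N_d])\cap\mathbb{Z}^d$, and let $A\subseteq P$ satisfy $|A|\ge\alpha|P|$. Then there is a subset $A'\subseteq A$ with $|A'|\ge(1-\eta)|A|$ such that, for every integer $k>\ell$ and every $x\in kA'$, there are at least $(\delta|A|)^{k-\ell}$ tuples $(y,a_1,\dots,a_{k-\ell})$ with $y\in\ell P$, $a_1,\dots,a_{k-\ell}\in A$ and $$x=y+a_1+\cdots+a_{k-\ell}.$$ Here $nB=\{b_1+\cdots+b_n : b_1,\dots,b_n\in B\}$ denotes the $n$-fold iterated sumset. -/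

import Mathlib

/-- The lattice box `([-N₁, N₁] × ⋯ × [-N_d, N_d]) ∩ ℤ^d`. -/
noncomputable def latticeBox {d : ℕ} (N : Fin d → ℕ) : Finset (Fin d → ℤ) :=
  Fintype.piFinset fun i => Finset.Icc (-(N i : ℤ)) (N i)

/-- The iterated sumset `kA = {a₁ + ⋯ + a_k : a₁, …, a_k ∈ A}` (not the dilate `{k a : a ∈ A}`). -/
def iterSumset {G : Type*} [AddCommMonoid G] (k : ℕ) (A : Finset G) : Set G :=
  {x | ∃ a : Fin k → G, (∀ i, a i ∈ A) ∧ x = ∑ i, a i}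

/-- The representations `x = y + a₁ + ⋯ + a_n` with `y ∈ Y` and `a₁, …, a_n ∈ A`,
as ordered tuples `(y, (a₁, …, a_n))`. -/
def representations {G : Type*} [AddCommMonoid G] (Y : Set G) (A : Finset G) (n : ℕ) (x : G) :
    Set (G × (Fin n → G)) :=
  {r | r.1 ∈ Y ∧ (∀ i, r.2 i ∈ A) ∧ x = r.1 + ∑ i, r.2 i}

/-! Cut the box into about `K ^ d` cells of relative side `1 / K`. Discard the points of `A` in
sparsely filled cells, then those that along some long axis (`K ≤ N i`) lack a far rich point on one
side; for large `K` and small `δ` this loses at most `η * |A|`, and `A'` is the rest. Given a sum of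
`k` elements of `A'`, keep the last `ℓ` and replace the others one at a time by elements of `A`,
controlling the accumulated error `e`. At each step take the axis with the largest `|e i| / N i` and
replace `x` by any point in the cell of a rich point far from `x` in the direction that lowers it.
This gives `δ * |A|` choices and a negative drift, so the normalized norm stays bounded
(`boundedError_step`). The kept summands avoid the ends of the long axes, so for large `ℓ` they
absorb the error inside `ℓP`. -/

open Finset

/-! ### Counting tuples; sumsets of boxes -/

section Sumsets

/-- Counting tuples greedily: if from every error satisfying `Inv` each step `x ∈ A'` can be answered
by at least `c` elements of `A` keeping `Inv`, then there are at least `c ^ m` good tuples. -/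
lemma pow_le_card_tuples {G : Type*} [AddCommGroup G] [DecidableEq G] {A A' : Finset G} {c : ℝ}
    (hc : 0 ≤ c) {Inv : G → Prop} (h0 : Inv 0)
    (hstep : ∀ e, Inv e → ∀ x ∈ A', ∃ S ⊆ A, c ≤ (S.card : ℝ) ∧ ∀ a ∈ S, Inv (e + (x - a)))
    (m : ℕ) (x : Fin m → G) (hx : ∀ i, x i ∈ A') :
    ∃ T : Finset (Fin m → G), c ^ m ≤ (T.card : ℝ) ∧
      ∀ a ∈ T, (∀ i, a i ∈ A) ∧ Inv (∑ i, x i - ∑ i, a i) := by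
  induction m with
  | zero => exact ⟨{0}, by simp, fun a _ => ⟨fun i => i.elim0, by simpa using h0⟩⟩
  | succ m ih =>
    obtain ⟨T, hT, hTa⟩ := ih (fun i => x i.castSucc) fun i => hx _
    have key : ∀ a : Fin m → G, ∃ S ⊆ A, a ∈ T → (c ≤ (S.card : ℝ) ∧
        ∀ b ∈ S, Inv (∑ i : Fin m, x i.castSucc - ∑ i, a i + (x (Fin.last m) - b))) := by
      intro a
      by_cases ha : a ∈ T
      · obtain ⟨S, hS, h⟩ := hstep _ (hTa a ha).2 _ (hx (Fin.last m))
        exact ⟨S, hS, fun _ => h⟩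
      · exact ⟨∅, by simp, fun h => absurd h ha⟩
    choose S hSA hS using key
    have hinj : Function.Injective
        fun p : (_ : Fin m → G) × G => (Fin.snoc p.1 p.2 : Fin (m + 1) → G) := by
      rintro ⟨a, b⟩ ⟨a', b'⟩ h
      obtain ⟨h1, h2⟩ := Fin.snoc_injective2 h
      subst h1 h2
      rfl
    refine ⟨(T.sigma S).map ⟨_, hinj⟩, ?_, ?_⟩
    · rw [card_map, card_sigma, pow_succ]
      push_cast
      calc c ^ m * c ≤ T.card * c := by gcongr
        _ = ∑ _a ∈ T, c := by simp
        _ ≤ _ := sum_le_sum fun a ha => (hS a ha).1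
    · intro a ha
      simp only [mem_map, mem_sigma, Function.Embedding.coeFn_mk] at ha
      obtain ⟨⟨p, b⟩, ⟨hp, hb⟩, rfl⟩ := ha
      refine ⟨fun i => ?_, ?_⟩
      · refine Fin.lastCases ?_ (fun j => ?_) i
        · simpa using hSA _ hb
        · simpa using (hTa p hp).1 j
      · have := (hS p hp).2 b hb
        rw [Fin.sum_univ_castSucc, Fin.sum_univ_castSucc]
        simp only [Fin.snoc_castSucc, Fin.snoc_last]
        convert this using 1
        abel

lemma representations_finite {G : Type*} [AddCommGroup G] (Y : Set G) (A : Finset G) (n : ℕ)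
    (x : G) : (representations Y A n x).Finite := by
  have hfin : {a : Fin n → G | ∀ i, a i ∈ A}.Finite := by
    have := Set.Finite.pi' (fun _ : Fin n => A.finite_toSet)
    simpa using this
  refine (hfin.image fun a => (x - ∑ i, a i, a)).subset ?_
  rintro ⟨y, a⟩ ⟨-, ha, hxy⟩
  exact ⟨a, ha, by simp [hxy]⟩

lemma card_le_ncard_representations {G : Type*} [AddCommGroup G] {Y : Set G} {A : Finset G}
    {n : ℕ} {x : G} (T : Finset (Fin n → G))
    (hT : ∀ a ∈ T, (∀ i, a i ∈ A) ∧ x - ∑ i, a i ∈ Y) :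
    T.card ≤ (representations Y A n x).ncard := by
  have hinj : Function.Injective fun a : Fin n → G => (x - ∑ i, a i, a) :=
    fun a b h => congrArg Prod.snd h
  rw [← Set.ncard_coe_finset T, ← Set.ncard_image_of_injective _ hinj]
  refine Set.ncard_le_ncard ?_ (representations_finite Y A n x)
  rintro _ ⟨a, ha, rfl⟩
  exact ⟨(hT a ha).2, (hT a ha).1, by simp⟩

lemma Int.exists_sum_eq_of_abs_le (n : ℕ) (l : ℕ) (y : ℤ) (hy : |y| ≤ l * n) :
    ∃ b : Fin l → ℤ, (∀ i, |b i| ≤ n) ∧ y = ∑ i, b i := by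
  induction l generalizing y with
  | zero => exact ⟨0, fun i => i.elim0, by simpa using hy⟩
  | succ l ih =>
    -- `c` is `y` clamped to `[-n, n]`.
    have hc : ∃ c : ℤ, |c| ≤ n ∧ |y - c| ≤ l * n := by
      rw [abs_le] at hy
      push_cast at hy
      have hln : (0 : ℤ) ≤ l * n := by positivity
      rcases le_total y (-n) with h | h
      · exact ⟨-n, by simp, abs_le.2 ⟨by linarith, by linarith⟩⟩
      rcases le_total y n with h' | h'
      · exact ⟨y, abs_le.2 ⟨h, h'⟩, by simpa using hln⟩
      · exact ⟨n, by simp, abs_le.2 ⟨by linarith, by linarith⟩⟩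
    obtain ⟨c, hc, hyc⟩ := hc
    obtain ⟨b, hb, hs⟩ := ih _ hyc
    refine ⟨Fin.cons c b, fun i => Fin.cases (by simpa using hc) (fun j => by simpa using hb j) i, ?_⟩
    rw [Fin.sum_cons, ← hs]
    ring

variable {d : ℕ}

lemma mem_latticeBox {N : Fin d → ℕ} {x : Fin d → ℤ} :
    x ∈ latticeBox N ↔ ∀ i, |x i| ≤ N i := by
  simp [latticeBox, abs_le]

lemma card_latticeBox (N : Fin d → ℕ) : (latticeBox N).card = ∏ i, (2 * N i + 1) := by
  rw [latticeBox, Fintype.card_piFinset]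
  refine prod_congr rfl fun i _ => ?_
  rw [Int.card_Icc]
  omega

lemma mem_iterSumset_latticeBox {N : Fin d → ℕ} {l : ℕ} {y : Fin d → ℤ}
    (hy : ∀ i, |y i| ≤ l * N i) : y ∈ iterSumset l (latticeBox N) := by
  choose b hb hs using fun i => Int.exists_sum_eq_of_abs_le (N i) l (y i) (hy i)
  refine ⟨fun j i => b i j, fun j => mem_latticeBox.2 fun i => hb i j, ?_⟩
  ext i
  rw [Finset.sum_apply, hs]

end Sumsets

/-! ### Rich cells -/

section Cells

variable {d : ℕ}

/-- The index of the cell of side lengths `⌊N i / K⌋ + 1` that contains `x`. -/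
def cellIndex (K : ℕ) (N : Fin d → ℕ) (x : Fin d → ℤ) : Fin d → ℤ :=
  fun i => x i / ((N i / K : ℕ) + 1 : ℤ)

lemma mul_abs_sub_le_of_cellIndex_eq {K : ℕ} {N : Fin d → ℕ} {a b : Fin d → ℤ}
    (h : cellIndex K N a = cellIndex K N b) (i : Fin d) : K * |a i - b i| ≤ N i := by
  have hi : a i / ((N i / K : ℕ) + 1 : ℤ) = b i / ((N i / K : ℕ) + 1 : ℤ) := congrFun h i
  have hw : (0 : ℤ) < (N i / K : ℕ) + 1 := by positivity
  have h1 := Int.emod_add_mul_ediv (a i) ((N i / K : ℕ) + 1 : ℤ)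
  have h2 := Int.emod_add_mul_ediv (b i) ((N i / K : ℕ) + 1 : ℤ)
  have h3 := Int.emod_nonneg (a i) hw.ne'
  have h4 := Int.emod_nonneg (b i) hw.ne'
  have h5 := Int.emod_lt_of_pos (a i) hw
  have h6 := Int.emod_lt_of_pos (b i) hw
  rw [hi] at h1
  have h7 : |a i - b i| ≤ (N i / K : ℕ) := abs_le.2 ⟨by linarith, by linarith⟩
  have h8 : K * (N i / K) ≤ N i := Nat.mul_div_le _ _
  calc (K : ℤ) * |a i - b i| ≤ K * (N i / K : ℕ) := by gcongr
    _ ≤ N i := by exact_mod_cast h8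

/-- On a short axis (`n < K`) a cell has width one, so no error can arise there. -/
lemma eq_of_mul_abs_sub_le {K n : ℕ} {a b : ℤ} (h : K * |a - b| ≤ n) (hn : n < K) : a = b := by
  by_contra hab
  have : (1 : ℤ) ≤ |a - b| := Int.one_le_abs (sub_ne_zero.2 hab)
  have : (K : ℤ) * 1 ≤ K * |a - b| := by gcongr
  have : (n : ℤ) < K := by exact_mod_cast hn
  linarith

lemma cellIndex_mem_latticeBox {K : ℕ} (hK : 0 < K) {N : Fin d → ℕ} {x : Fin d → ℤ}
    (hx : x ∈ latticeBox N) : cellIndex K N x ∈ latticeBox fun _ : Fin d => K := by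
  rw [mem_latticeBox] at hx ⊢
  intro i
  have hw : (0 : ℤ) < (N i / K : ℕ) + 1 := by positivity
  have h1 : (N i : ℤ) < ((N i / K : ℕ) + 1) * K := by
    have := Nat.lt_div_mul_add (a := N i) hK
    have h2 : N i < (N i / K + 1) * K := by rw [add_mul, one_mul]; exact this
    exact_mod_cast h2
  obtain ⟨h2, h3⟩ := abs_le.1 (hx i)
  refine abs_le.2 ⟨?_, ?_⟩
  · exact (Int.le_ediv_iff_mul_le hw).2 (by linarith)
  · exact (Int.ediv_lt_of_lt_mul hw (by linarith)).le

/-- The elements of `A` whose cell contains at least `c` elements of `A`. -/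
noncomputable def richPart (K : ℕ) (N : Fin d → ℕ) (A : Finset (Fin d → ℤ)) (c : ℝ) :
    Finset (Fin d → ℤ) :=
  open Classical in
  {x ∈ A | c ≤ (({a ∈ A | cellIndex K N a = cellIndex K N x}).card : ℝ)}

/-- At most `(2 * K + 1) ^ d` cells meet the box, and each poor one holds fewer than `c` points of
`A`. -/
lemma card_sdiff_richPart_le {K : ℕ} (hK : 0 < K) {N : Fin d → ℕ} {A : Finset (Fin d → ℤ)}
    (hA : A ⊆ latticeBox N) {c : ℝ} (hc0 : 0 ≤ c) :
    ((A \ richPart K N A c).card : ℝ) ≤ (2 * K + 1) ^ d * c := by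
  classical
  have hc : ∀ x ∈ A \ richPart K N A c,
      (({a ∈ A | cellIndex K N a = cellIndex K N x}).card : ℝ) < c := by
    intro x hx
    simp only [richPart, mem_sdiff, mem_filter, not_and, not_le] at hx
    exact hx.2 hx.1
  have hmaps : ∀ x ∈ A \ richPart K N A c,
      cellIndex K N x ∈ (A \ richPart K N A c).image (cellIndex K N) :=
    fun x hx => mem_image_of_mem _ hx
  rw [card_eq_sum_card_fiberwise hmaps]
  push_cast
  have hcard : ((A \ richPart K N A c).image (cellIndex K N)).card ≤ (2 * K + 1) ^ d := by
    have : (latticeBox fun _ : Fin d => K).card = (2 * K + 1) ^ d := by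
      simp [card_latticeBox]
    rw [← this]
    refine card_le_card fun q hq => ?_
    obtain ⟨x, hx, rfl⟩ := mem_image.1 hq
    exact cellIndex_mem_latticeBox hK (hA (mem_sdiff.1 hx).1)
  calc _ ≤ ∑ _q ∈ (A \ richPart K N A c).image (cellIndex K N), c := by
        refine sum_le_sum fun q hq => ?_
        obtain ⟨x, hx, rfl⟩ := mem_image.1 hq
        refine le_trans ?_ (hc x hx).le
        exact_mod_cast card_le_card (filter_subset_filter _ sdiff_subset)
    _ = ((A \ richPart K N A c).image (cellIndex K N)).card * c := by simp
    _ ≤ _ := by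
        gcongr
        exact_mod_cast hcard

/-! ### Extreme and deep points -/

/-- The elements of `R` beyond which, in direction `s` along the `i`-th axis, there is no element of
`R` at distance at least `(d + 1) N i / K`. -/
noncomputable def extremePart (K : ℕ) (N : Fin d → ℕ) (R : Finset (Fin d → ℤ)) (i : Fin d)
    (s : ℤ) : Finset (Fin d → ℤ) :=
  open Classical in
  {x ∈ R | ¬ ∃ x' ∈ R, (∀ j, j ≠ i → x' j = x j) ∧ (d + 1) * (N i : ℤ) ≤ K * (s * (x' i - x i))}

lemma Int.mul_card_le_of_pairwise_sub_lt {K D : ℕ} (S : Finset ℤ)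
    (h : ∀ x ∈ S, ∀ y ∈ S, (K : ℤ) * (y - x) ≤ D) : K * S.card ≤ D + K := by
  rcases S.eq_empty_or_nonempty with rfl | hS
  · simp
  have h1 := h _ (S.min'_mem hS) _ (S.max'_mem hS)
  have h2 : S.card ≤ (S.max' hS + 1 - S.min' hS).toNat := by
    rw [← Int.card_Icc]
    exact card_le_card fun x hx => mem_Icc.2 ⟨S.min'_le x hx, S.le_max' x hx⟩
  have h3 : (S.card : ℤ) ≤ S.max' hS + 1 - S.min' hS := by
    have := S.min'_le _ (S.max'_mem hS)
    omega
  zify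
  calc (K : ℤ) * S.card ≤ K * (S.max' hS + 1 - S.min' hS) := by gcongr
    _ ≤ D + K := by linarith

/-- Two extreme points on one line parallel to the axis cannot be far apart, so each line carries
only about a `(d + 2) / (2 * K)` fraction of its box points. -/
lemma two_mul_card_extremePart_le {K : ℕ} {N : Fin d → ℕ} {R : Finset (Fin d → ℤ)}
    (hR : R ⊆ latticeBox N) {i : Fin d} (hi : K ≤ N i) {s : ℤ} (hs : s = 1 ∨ s = -1) :
    2 * (K * (extremePart K N R i s).card) ≤ (d + 2) * (latticeBox N).card := by
  classical
  set E := extremePart K N R i s with hE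
  have hER : E ⊆ R := filter_subset _ _
  have hfib : ∀ b ∈ E.image (fun x => Function.update x i 0),
      K * ({x ∈ E | Function.update x i 0 = b}).card ≤ (d + 1) * N i + K := by
    intro b _
    have hinj : Set.InjOn (fun x : Fin d → ℤ => x i)
        ({x ∈ E | Function.update x i 0 = b} : Finset (Fin d → ℤ)) := by
      intro x hx y hy hxy
      simp only [coe_filter, Set.mem_ofPred_eq] at hx hy
      ext j
      by_cases hj : j = i
      · subst hj; exact hxy
      · have := congrFun (hx.2.trans hy.2.symm) j
        simpa [hj] using this
    rw [← card_image_of_injOn hinj]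
    refine Int.mul_card_le_of_pairwise_sub_lt _ ?_
    have key : ∀ x ∈ E, ∀ y ∈ E, Function.update x i 0 = b → Function.update y i 0 = b →
        (K : ℤ) * (s * (y i - x i)) ≤ (d + 1) * N i := by
      intro x hx y hy hxb hyb
      by_contra hlt
      refine (mem_filter.1 hx).2 ⟨y, hER hy, fun j hj => ?_, (not_le.1 hlt).le⟩
      have := congrFun (hyb.trans hxb.symm) j
      simpa [hj] using this
    intro u hu v hv
    obtain ⟨x, hx, rfl⟩ := mem_image.1 hu
    obtain ⟨y, hy, rfl⟩ := mem_image.1 hv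
    rw [mem_filter] at hx hy
    push_cast
    rcases hs with rfl | rfl
    · simpa using key x hx.1 y hy.1 hx.2 hy.2
    · simpa using key y hy.1 x hx.1 hy.2 hx.2
  have hcard : E.card = ∑ b ∈ E.image (fun x => Function.update x i 0),
      ({x ∈ E | Function.update x i 0 = b}).card :=
    card_eq_sum_card_fiberwise fun x hx => mem_image_of_mem _ hx
  have himage : (E.image fun x => Function.update x i 0).card ≤
      (latticeBox (Function.update N i 0)).card := by
    refine card_le_card fun b hb => ?_
    obtain ⟨x, hx, rfl⟩ := mem_image.1 hb
    rw [mem_latticeBox]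
    intro j
    by_cases hj : j = i
    · subst hj; simp
    · simpa [hj] using mem_latticeBox.1 (hR (hER hx)) j
  have hbox : (latticeBox (Function.update N i 0)).card * (2 * N i + 1) =
      (latticeBox N).card := by
    rw [card_latticeBox, card_latticeBox, ← mul_prod_erase univ _ (mem_univ i),
      ← mul_prod_erase univ (fun j => 2 * N j + 1) (mem_univ i)]
    have : ∏ j ∈ univ.erase i, (2 * Function.update N i 0 j + 1) =
        ∏ j ∈ univ.erase i, (2 * N j + 1) :=
      prod_congr rfl fun j hj => by rw [Function.update_of_ne (ne_of_mem_erase hj)]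
    rw [this]
    simp [mul_comm]
  calc 2 * (K * E.card)
      ≤ 2 * ((E.image fun x => Function.update x i 0).card * ((d + 1) * N i + K)) := by
        refine Nat.mul_le_mul_left 2 ?_
        rw [hcard, mul_sum]
        simpa using sum_le_sum hfib
    -- The endpoint term `K` is absorbed by `K ≤ N i`.
    _ ≤ 2 * ((latticeBox (Function.update N i 0)).card * ((d + 1) * N i + N i)) := by gcongr
    _ = (d + 2) * ((latticeBox (Function.update N i 0)).card * (2 * N i)) := by ring
    _ ≤ (d + 2) * ((latticeBox (Function.update N i 0)).card * (2 * N i + 1)) := by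
        gcongr; omega
    _ = _ := by rw [hbox]

/-- Along every axis with `K ≤ N i`, the element `x` is far from extreme in `R` in both
directions. -/
def IsDeep (K : ℕ) (N : Fin d → ℕ) (R : Finset (Fin d → ℤ)) (x : Fin d → ℤ) : Prop :=
  ∀ i, K ≤ N i → ∀ s : ℤ, s = 1 ∨ s = -1 →
    ∃ x' ∈ R, (∀ j, j ≠ i → x' j = x j) ∧ (d + 1) * (N i : ℤ) ≤ K * (s * (x' i - x i))

/-- The rich elements of `A` that are deep among the rich elements. -/
noncomputable def deepPart (K : ℕ) (N : Fin d → ℕ) (A : Finset (Fin d → ℤ)) (c : ℝ) :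
    Finset (Fin d → ℤ) :=
  open Classical in {x ∈ richPart K N A c | IsDeep K N (richPart K N A c) x}

lemma deepPart_subset {K : ℕ} {N : Fin d → ℕ} {A : Finset (Fin d → ℤ)} {c : ℝ} :
    deepPart K N A c ⊆ A := by
  classical
  exact fun _ hx => (mem_filter.1 (mem_filter.1 hx).1).1

lemma card_sdiff_deepPart_le {K : ℕ} (hK : 0 < K) {N : Fin d → ℕ} {A : Finset (Fin d → ℤ)}
    (hA : A ⊆ latticeBox N) {c : ℝ} (hc : 0 ≤ c) :
    ((A \ deepPart K N A c).card : ℝ) ≤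
      (2 * K + 1) ^ d * c + d * (d + 2) / K * (latticeBox N).card := by
  classical
  set R := richPart K N A c with hRdef
  have hRP : R ⊆ latticeBox N := (filter_subset _ _).trans hA
  set U := univ.filter (fun i : Fin d => K ≤ N i)
  have hcover : A \ deepPart K N A c ⊆
      (A \ R) ∪ U.biUnion fun i => extremePart K N R i 1 ∪ extremePart K N R i (-1) := by
    intro x hx
    rw [mem_sdiff] at hx
    by_cases hxR : x ∈ R
    swap
    · exact mem_union_left _ (mem_sdiff.2 ⟨hx.1, hxR⟩)
    refine mem_union_right _ ?_
    have h := hx.2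
    simp only [deepPart, mem_filter, not_and] at h
    have h := h hxR
    unfold IsDeep at h
    push Not at h
    obtain ⟨i, hi, s, hs, h⟩ := h
    refine mem_biUnion.2 ⟨i, mem_filter.2 ⟨mem_univ _, hi⟩, ?_⟩
    have hxE : x ∈ extremePart K N R i s := by
      refine mem_filter.2 ⟨hxR, ?_⟩
      rintro ⟨x', hx', h1, h2⟩
      exact absurd (h x' hx' h1) (not_lt.2 h2)
    rcases hs with rfl | rfl
    · exact mem_union_left _ hxE
    · exact mem_union_right _ hxE
  have hK' : (0 : ℝ) < K := by exact_mod_cast hK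
  have hE : ∀ i ∈ U, ∀ s : ℤ, s = 1 ∨ s = -1 →
      ((extremePart K N R i s).card : ℝ) ≤ (d + 2) / K * (latticeBox N).card / 2 := by
    intro i hi s hs
    have := two_mul_card_extremePart_le hRP (mem_filter.1 hi).2 hs
    have h2 : (2 : ℝ) * (K * (extremePart K N R i s).card) ≤ (d + 2) * (latticeBox N).card := by
      exact_mod_cast this
    rw [div_mul_eq_mul_div, div_div, le_div_iff₀ (by positivity)]
    linarith
  have hU : ((U.biUnion fun i => extremePart K N R i 1 ∪ extremePart K N R i (-1)).card : ℝ) ≤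
      d * ((d + 2) / K * (latticeBox N).card) := by
    calc _ ≤ ((∑ i ∈ U, (extremePart K N R i 1 ∪ extremePart K N R i (-1)).card : ℕ) : ℝ) := by
          exact_mod_cast card_biUnion_le
      _ = ∑ i ∈ U, ((extremePart K N R i 1 ∪ extremePart K N R i (-1)).card : ℝ) := by
          push_cast; rfl
      _ ≤ ∑ i ∈ U, ((d + 2) / K * (latticeBox N).card : ℝ) := by
          refine sum_le_sum fun i hi => ?_
          have h1 := hE i hi 1 (Or.inl rfl)
          have h2 := hE i hi (-1) (Or.inr rfl)
          have h3 : ((extremePart K N R i 1 ∪ extremePart K N R i (-1)).card : ℝ) ≤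
              (extremePart K N R i 1).card + (extremePart K N R i (-1)).card := by
            exact_mod_cast card_union_le _ _
          linarith
      _ = U.card * ((d + 2) / K * (latticeBox N).card : ℝ) := by simp
      _ ≤ _ := by
          gcongr
          simpa using card_le_univ U
  have h1 : ((A \ deepPart K N A c).card : ℝ) ≤ (A \ R).card +
      (U.biUnion fun i => extremePart K N R i 1 ∪ extremePart K N R i (-1)).card := by
    exact_mod_cast (card_le_card hcover).trans (card_union_le _ _)
  have h2 := card_sdiff_richPart_le hK hA hc
  have h3 : (d : ℝ) * ((d + 2) / K * (latticeBox N).card) =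
      d * (d + 2) / K * (latticeBox N).card := by ring
  linarith

/-- The far points on both sides of `x` still lie in the box, which leaves `x` a margin of `N i /
K`. -/
lemma abs_le_of_mem_deepPart {K : ℕ} {N : Fin d → ℕ} {A : Finset (Fin d → ℤ)}
    (hA : A ⊆ latticeBox N) {c : ℝ} {x : Fin d → ℤ} (hx : x ∈ deepPart K N A c) {i : Fin d}
    (hi : K ≤ N i) : K * |x i| + N i ≤ K * N i := by
  classical
  have h := (mem_filter.1 hx).2 i hi
  obtain ⟨x₁, hx₁, -, h₁⟩ := h 1 (Or.inl rfl)
  obtain ⟨x₂, hx₂, -, h₂⟩ := h (-1) (Or.inr rfl)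
  have hb₁ := (abs_le.1 (mem_latticeBox.1 (hA (filter_subset _ _ hx₁)) i)).2
  have hb₂ := (abs_le.1 (mem_latticeBox.1 (hA (filter_subset _ _ hx₂)) i)).1
  have hd : (0 : ℤ) ≤ d * N i := by positivity
  have hK : (0 : ℤ) ≤ K := by positivity
  have := mul_le_mul_of_nonneg_left hb₁ hK
  have := mul_le_mul_of_nonneg_left hb₂ hK
  rcases abs_cases (x i) with ⟨h, -⟩ | ⟨h, -⟩ <;> rw [h] <;> nlinarith

end Cells

/-! ### Keeping the error bounded -/

section Drift

variable {d : ℕ}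

/-- The errors that vanish on the short axes and have bounded normalized Euclidean norm. -/
def BoundedError (K : ℕ) (N : Fin d → ℕ) (e : Fin d → ℤ) : Prop :=
  ∑ i, ((e i : ℝ) / N i) ^ 2 ≤ 4 * d ^ 3 * K ^ 2 + 4 * d ∧ ∀ i, N i < K → e i = 0

lemma boundedError_zero (K : ℕ) (N : Fin d → ℕ) : BoundedError K N 0 :=
  ⟨by simp; positivity, fun _ _ => rfl⟩

/-- The gain `d / K` on the dominant axis beats the loss of `1 / K` on each of the `d - 1` others,
so the inner product of `f` and `h` is at most `-|f i| / K`. If `|f i| ≥ 2 * d * K`, this outweighs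
the quadratic term `4 * d`; otherwise the norm is small enough to afford it. -/
lemma sum_sq_add_le_of_drift {K : ℝ} (hK : 0 < K) {f h : Fin d → ℝ} (i : Fin d)
    (hmax : ∀ j, |f j| ≤ |f i|) (hf : ∑ j, f j ^ 2 ≤ 4 * d ^ 3 * K ^ 2 + 4 * d)
    (hh : ∀ j, |h j| ≤ 2) (hj : ∀ j, j ≠ i → |h j| ≤ 1 / K)
    (hi : f i * h i ≤ -(d / K) * |f i|) :
    ∑ j, (f j + h j) ^ 2 ≤ 4 * d ^ 3 * K ^ 2 + 4 * d := by
  have h1 : ∑ j, f j * h j ≤ -(|f i| / K) := by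
    have : ∀ j ∈ univ, f j * h j ≤ |f i| / K - if j = i then (d + 1) / K * |f i| else 0 := by
      intro j _
      split_ifs with hji
      · subst hji
        refine hi.trans (le_of_eq ?_)
        ring
      · calc f j * h j ≤ |f j| * |h j| := by rw [← abs_mul]; exact le_abs_self _
          _ ≤ |f i| * (1 / K) :=
              mul_le_mul (hmax j) (hj j hji) (abs_nonneg _) (abs_nonneg _)
          _ = _ := by ring
    refine (sum_le_sum this).trans (le_of_eq ?_)
    rw [sum_sub_distrib, sum_ite_eq' univ i]
    simp
    ring
  have h2 : ∑ j, h j ^ 2 ≤ 4 * d := by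
    calc ∑ j, h j ^ 2 ≤ ∑ _j : Fin d, (4 : ℝ) := sum_le_sum fun j _ => by
          rw [← sq_abs]; nlinarith [hh j, abs_nonneg (h j)]
      _ = 4 * d := by simp [mul_comm]
  have h3 : ∑ j, (f j + h j) ^ 2 = ∑ j, f j ^ 2 + 2 * ∑ j, f j * h j + ∑ j, h j ^ 2 := by
    rw [mul_sum, ← sum_add_distrib, ← sum_add_distrib]
    exact sum_congr rfl fun j _ => by ring
  rw [h3]
  rcases le_total (2 * d * K) |f i| with hF | hF
  · have : 2 * d ≤ |f i| / K := (le_div_iff₀ hK).2 hF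
    linarith
  · have h4 : ∑ j, f j ^ 2 ≤ 4 * d ^ 3 * K ^ 2 := by
      calc ∑ j, f j ^ 2 ≤ ∑ _j : Fin d, (2 * d * K) ^ 2 := sum_le_sum fun j _ => by
            rw [← sq_abs]
            gcongr
            exact (hmax j).trans hF
        _ = _ := by simp; ring
    have : 0 ≤ |f i| / K := by positivity
    linarith

lemma boundedError_step {K : ℕ} (hK : 0 < K) {N : Fin d → ℕ} (hN : ∀ i, 0 < N i)
    {A : Finset (Fin d → ℤ)} (hA : A ⊆ latticeBox N) {c : ℝ} {e : Fin d → ℤ}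
    (he : BoundedError K N e) {x : Fin d → ℤ} (hx : x ∈ deepPart K N A c) :
    ∃ S ⊆ A, c ≤ (S.card : ℝ) ∧ ∀ a ∈ S, BoundedError K N (e + (x - a)) := by
  classical
  have hK' : (0 : ℝ) < K := by exact_mod_cast hK
  have hN' : ∀ i, (0 : ℝ) < N i := fun i => by exact_mod_cast hN i
  have hxR : x ∈ richPart K N A c := (mem_filter.1 hx).1
  by_cases hlarge : ∃ i, K ≤ N i
  swap
  -- All axes are short, so the cell of `x` is a single point and the error does not change.
  · push Not at hlarge
    refine ⟨_, filter_subset _ _, (mem_filter.1 hxR).2, fun a ha => ?_⟩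
    have hax : a = x := funext fun j => eq_of_mul_abs_sub_le
      (mul_abs_sub_le_of_cellIndex_eq (mem_filter.1 ha).2 j) (hlarge j)
    simpa [hax] using he
  have hne : (univ.filter fun i : Fin d => K ≤ N i).Nonempty :=
    hlarge.imp fun i hi => mem_filter.2 ⟨mem_univ _, hi⟩
  obtain ⟨i, hiU, hmax⟩ := exists_max_image _ (fun j => |(e j : ℝ) / N j|) hne
  have hi : K ≤ N i := (mem_filter.1 hiU).2
  have hmax' : ∀ j, |(e j : ℝ) / N j| ≤ |(e i : ℝ) / N i| := by
    intro j
    rcases lt_or_ge (N j) K with hj | hj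
    · simp [he.2 j hj]
    · exact hmax j (mem_filter.2 ⟨mem_univ _, hj⟩)
  obtain ⟨s, hs, hse⟩ : ∃ s : ℤ, (s = 1 ∨ s = -1) ∧ e i = s * |e i| := by
    rcases abs_cases (e i) with ⟨h, -⟩ | ⟨h, -⟩
    · exact ⟨1, Or.inl rfl, by rw [h]; ring⟩
    · exact ⟨-1, Or.inr rfl, by rw [h]; ring⟩
  obtain ⟨x', hx', hline, hfar⟩ := (mem_filter.1 hx).2 i hi s hs
  refine ⟨_, filter_subset _ _, (mem_filter.1 hx').2, fun a ha => ?_⟩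
  rw [mem_filter] at ha
  have hcell := mul_abs_sub_le_of_cellIndex_eq ha.2
  have hax : ∀ j, j ≠ i → K * |a j - x j| ≤ N j := fun j hj => hline j hj ▸ hcell j
  -- Of the distance `(d + 1) * N i / K` to `x'`, moving within its cell costs at most `N i / K`.
  have hai : d * (N i : ℤ) ≤ K * (s * (a i - x i)) := by
    have h1 : -(s * (a i - x' i)) ≤ |a i - x' i| := by
      rcases hs with rfl | rfl
      · simpa using neg_le_abs (a i - x' i)
      · simpa using le_abs_self (a i - x' i)
    have h2 : (K : ℤ) * -(s * (a i - x' i)) ≤ N i :=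
      (mul_le_mul_of_nonneg_left h1 (by positivity)).trans (hcell i)
    linarith
  refine ⟨?_, fun j hj => ?_⟩
  · have hsum : ∀ j, (((e + (x - a)) j : ℤ) : ℝ) / N j =
        (e j : ℝ) / N j + (x j - a j : ℝ) / N j := by
      intro j
      simp only [Pi.add_apply, Pi.sub_apply]
      push_cast
      ring
    simp only [hsum]
    refine sum_sq_add_le_of_drift hK' i hmax' he.1 (fun j => ?_) (fun j hj => ?_) ?_
    · rw [abs_div, abs_of_pos (hN' j), div_le_iff₀ (hN' j)]
      have h1 : |(x j : ℝ)| ≤ N j := by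
        exact_mod_cast mem_latticeBox.1 (hA (deepPart_subset hx)) j
      have h2 : |(a j : ℝ)| ≤ N j := by exact_mod_cast mem_latticeBox.1 (hA ha.1) j
      have := abs_sub (x j : ℝ) (a j)
      linarith
    · rw [abs_div, abs_of_pos (hN' j), div_le_div_iff₀ (hN' j) hK', abs_sub_comm]
      have : (K : ℝ) * |(a j : ℝ) - x j| ≤ N j := by exact_mod_cast hax j hj
      linarith
    · have h1 : (d : ℝ) * N i ≤ K * (s * (a i - x i)) := by exact_mod_cast hai
      have h2 : (e i : ℝ) = s * |(e i : ℝ)| := by exact_mod_cast hse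
      rw [abs_div, abs_of_pos (hN' i)]
      have h3 : (d : ℝ) / K ≤ s * (a i - x i) / N i := by
        rw [div_le_div_iff₀ hK' (hN' i)]
        linarith
      calc (e i : ℝ) / N i * ((x i - a i) / N i)
          = -(s * (a i - x i) / N i) * (|(e i : ℝ)| / N i) := by
            nth_rewrite 1 [h2]; ring
        _ ≤ -(d / K) * (|(e i : ℝ)| / N i) := by gcongr
  · have hji : j ≠ i := by rintro rfl; omega
    simp [he.2 j hj, eq_of_mul_abs_sub_le (hax j hji) hj]

lemma BoundedError.abs_le {K : ℕ} {N : Fin d → ℕ} (hN : ∀ i, 0 < N i) {e : Fin d → ℤ}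
    (he : BoundedError K N e) (i : Fin d) :
    |e i| ≤ (4 * d ^ 3 * K ^ 2 + 4 * d) * (N i : ℤ) := by
  have hN' : (0 : ℝ) < N i := by exact_mod_cast hN i
  have hd : (1 : ℝ) ≤ d := by exact_mod_cast i.pos
  set B : ℝ := 4 * d ^ 3 * K ^ 2 + 4 * d with hB
  have hB1 : 1 ≤ B := by
    have : (0 : ℝ) ≤ 4 * d ^ 3 * K ^ 2 := by positivity
    linarith
  have h1 : ((e i : ℝ) / N i) ^ 2 ≤ B :=
    (single_le_sum (f := fun j => ((e j : ℝ) / N j) ^ 2) (fun j _ => sq_nonneg _)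
      (mem_univ i)).trans he.1
  -- As `B ≥ 1`, `B ≤ B ^ 2` avoids a square root.
  have h2 : |(e i : ℝ) / N i| ≤ B := abs_le_of_sq_le_sq (by nlinarith) (by linarith)
  rw [abs_div, abs_of_pos hN', div_le_iff₀ hN'] at h2
  rw [hB] at h2
  exact_mod_cast h2

end Drift

/-! ### Choice of constants and conclusion -/

theorem mainTheorem6 (α η : ℝ) (hα : 0 < α) (hη : 0 < η) (d : ℕ) :
    ∃ ℓ : ℕ, 0 < ℓ ∧ ∃ δ : ℝ, 0 < δ ∧
      ∀ N : Fin d → ℕ, (∀ i, 0 < N i) →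
      ∀ A : Finset (Fin d → ℤ), A ⊆ latticeBox N →
        α * ((latticeBox N).card : ℝ) ≤ (A.card : ℝ) →
        ∃ A' : Finset (Fin d → ℤ), A' ⊆ A ∧ (1 - η) * (A.card : ℝ) ≤ (A'.card : ℝ) ∧
          ∀ k : ℕ, ℓ < k → ∀ x ∈ iterSumset k A',
            (δ * (A.card : ℝ)) ^ (k - ℓ) ≤
              ((representations (iterSumset ℓ (latticeBox N)) A (k - ℓ) x).ncard : ℝ) := by
  classical
  -- `K` limits the extreme points to `η / 2 * |A|`; `δ` does the same for poor cells.
  obtain ⟨K, hKlarge⟩ := exists_nat_gt (2 * d * (d + 2) / (α * η) : ℝ)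
  have hK' : (0 : ℝ) < K := lt_of_le_of_lt (by positivity) hKlarge
  have hK : 0 < K := by exact_mod_cast hK'
  set δ : ℝ := η / (2 * (2 * K + 1) ^ d) with hδ
  have hδ0 : 0 < δ := by positivity
  -- `K` times the bound on the normalized error; the `+ 1` keeps `ℓ` positive when `d = 0`.
  set ℓ : ℕ := K * (4 * d ^ 3 * K ^ 2 + 4 * d) + 1 with hℓ
  refine ⟨ℓ, Nat.succ_pos _, δ, hδ0, fun N hN A hA hαA => ?_⟩
  have hc : 0 ≤ δ * A.card := by positivity
  refine ⟨deepPart K N A (δ * A.card), deepPart_subset, ?_, ?_⟩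
  · have h1 := card_sdiff_deepPart_le hK hA hc
    have h2 : ((A \ deepPart K N A (δ * A.card)).card : ℝ) +
        (deepPart K N A (δ * A.card)).card = A.card := by
      exact_mod_cast card_sdiff_add_card_eq_card (deepPart_subset (A := A))
    have h3 : (2 * K + 1 : ℝ) ^ d * (δ * A.card) = η / 2 * A.card := by
      rw [hδ]; field_simp
    have h4 : (d * (d + 2) / K * (latticeBox N).card : ℝ) ≤ η / 2 * A.card := by
      rw [div_lt_iff₀ (by positivity)] at hKlarge
      have : (d * (d + 2) / K : ℝ) ≤ η / 2 * α := by
        rw [div_le_iff₀ hK']; linarith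
      calc (d * (d + 2) / K * (latticeBox N).card : ℝ) ≤ η / 2 * α * (latticeBox N).card := by
            gcongr
        _ = η / 2 * (α * (latticeBox N).card) := by ring
        _ ≤ _ := by gcongr
    linarith
  · rintro k hk x ⟨b, hb, rfl⟩
    obtain ⟨m, rfl⟩ := Nat.exists_eq_add_of_le' hk.le
    rw [Nat.add_sub_cancel]
    obtain ⟨T, hT, hTa⟩ := pow_le_card_tuples hc (boundedError_zero K N)
      (fun e he x hx => boundedError_step hK hN hA he hx) m (fun i => b (Fin.castAdd ℓ i))
      fun i => hb _
    refine hT.trans ?_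
    norm_cast
    refine card_le_ncard_representations T fun a ha => ⟨(hTa a ha).1, ?_⟩
    have he := (hTa a ha).2
    set e := ∑ i, b (Fin.castAdd ℓ i) - ∑ i, a i with hedef
    have hy : ∑ i, b i - ∑ i, a i = e + ∑ j, b (Fin.natAdd m j) := by
      rw [Fin.sum_univ_add, hedef]; abel
    rw [hy]
    refine mem_iterSumset_latticeBox fun i => ?_
    rw [Pi.add_apply, Finset.sum_apply]
    have htri : |∑ j, b (Fin.natAdd m j) i| ≤ ∑ j : Fin ℓ, |b (Fin.natAdd m j) i| :=
      abs_sum_le_sum_abs _ _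
    rcases lt_or_ge (N i) K with hi | hi
    · rw [he.2 i hi, zero_add]
      refine htri.trans ?_
      calc ∑ j : Fin ℓ, |b (Fin.natAdd m j) i| ≤ ∑ _j : Fin ℓ, (N i : ℤ) :=
            sum_le_sum fun j _ => mem_latticeBox.1 (hA (deepPart_subset (hb _))) i
        _ = ℓ * N i := by simp
    -- The `ℓ` margins of `N i / K` add up to room for `e i`.
    · have h1 : ∑ j : Fin ℓ, (K * |b (Fin.natAdd m j) i| + N i) ≤ ∑ _j : Fin ℓ, (K * N i : ℤ) :=
        sum_le_sum fun j _ => abs_le_of_mem_deepPart hA (hb _) hi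
      rw [sum_add_distrib, ← mul_sum] at h1
      simp only [sum_const, card_univ, Fintype.card_fin, nsmul_eq_mul] at h1
      have h2 : (K : ℤ) * |e i| ≤ ℓ * N i := by
        have h3 := he.abs_le hN i
        calc (K : ℤ) * |e i| ≤ K * ((4 * d ^ 3 * K ^ 2 + 4 * d) * (N i : ℤ)) := by gcongr
          _ ≤ (K * (4 * d ^ 3 * K ^ 2 + 4 * d) + 1) * (N i : ℤ) := by
              have : (0 : ℤ) ≤ N i := by positivity
              linarith
          _ = ℓ * N i := by rw [hℓ]; push_cast; ring
      have h4 : (K : ℤ) * (|e i| + ∑ j : Fin ℓ, |b (Fin.natAdd m j) i|) ≤ K * (ℓ * N i) := by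
        linarith
      have h5 := le_of_mul_le_mul_left h4 (by exact_mod_cast hK)
      exact (abs_add_le _ _).trans ((add_le_add_right htri _).trans h5)
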